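/- Let $X$ be a real normed space, let $K\subset X$ be a convex cone (a set closed under addition and under multiplication by positive scalars), and let $V\subset X$ be a neighbourhood of a point $\widehat w\in K$. Let $C(V,\mathbb R^m)$ denote the space of all bounded continuous mappings $G\colon V\to\mathbb R^m$ with the norm $\|G\|=\sup_{w\in V}|G(w)|$, where $|\cdot|$ is the Euclidean norm on $\mathbb R^m$. Let $\widehat G\in C(V,\mathbb R^m)$ be twice Fréchet differentiable at $\widehat w$ (that is, differentiable in a neighbourhood of $\widehat w$, with derivative differentiable at $\widehat w$). Let $q\in\operatorname{Ker}\widehat G'(\widehat w)\cap K$, $\|q\|=1$, and suppose that $$0\in\operatorname{int}\bigl\{\,\widehat G'(\widehat w)(K-\widehat w)+\operatorname{cone}\,\widehat G''(\widehat w)[q,q]\,\bigr\},$$ where $\operatorname{cone} a=\{\beta a:\beta\ge 0\}$ is the ray spanned by $a$. Then there exist a neighbourhood $V_1$ of the point $\widehat G(\widehat w)$ in $\mathbb R^m$ and a constant $\kappa>0$ such that for every $y\in V_1$ there exists a set $V_y\subset C(V,\mathbb R^m)$, which is a neighbourhood of $\widehat G$ in $C(V,\mathbb R^m)$ if $y\ne\widehat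 G(\widehat w)$ and is $V_y=\{\widehat G\}$ if $y=\widehat G(\widehat w)$, with the property that for every $G\in V_y$ there exists a point $w_G(y)\in V\cap K$ for which $$G(w_G(y))=y,\qquad \|w_G(y)-\widehat w\|\le\kappa\,|y-\widehat G(\widehat w)|^{1/2}.$$ -/

import Mathlib

open scoped Pointwise Topology BoundedContinuousFunction

/-- The extension by zero to the whole space `X` of a mapping given on a subset `V`. At an interior
point of `V` the Fréchet derivatives of `G` are those of any extension of `G`. -/
noncomputable def zeroExtend {X E : Type*} [Zero E] {V : Set X} (G : V → E) : X → E :=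
  Function.extend (Subtype.val : V → X) G 0

theorem zeroExtend_apply {X E : Type*} [Zero E] {V : Set X} (G : V → E) (w : V) :
    zeroExtend G (w : X) = G w :=
  Subtype.val_injective.extend_apply G 0 w

/-- `f` is twice (Fréchet) differentiable at `x`: it is differentiable in a neighbourhood of `x`
and its derivative is differentiable at `x`. -/
def TwiceDifferentiableAt {X E : Type*} [NormedAddCommGroup X] [NormedSpace ℝ X]
    [NormedAddCommGroup E] [NormedSpace ℝ E] (f : X → E) (x : X) : Prop :=
  (∀ᶠ w in 𝓝 x, DifferentiableAt ℝ f w) ∧ DifferentiableAt ℝ (fderiv ℝ f) x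

/-- The second derivative of `f` at `x` as a continuous bilinear mapping. -/
noncomputable def secondDeriv {X E : Type*} [NormedAddCommGroup X] [NormedSpace ℝ X]
    [NormedAddCommGroup E] [NormedSpace ℝ E] (f : X → E) (x : X) : X →L[ℝ] X →L[ℝ] E :=
  fderiv ℝ (fderiv ℝ f) x

/-- The ray `{β a : β ≥ 0}` spanned by a vector `a`. -/
def ray {E : Type*} [AddCommGroup E] [Module ℝ E] (a : E) : Set E :=
  {z | ∃ β : ℝ, 0 ≤ β ∧ z = β • a}

/-! ### Brouwer's fixed point theorem, by the Milnor–Rogers volume argument. -/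

section Brouwer

open Metric MeasureTheory Set

variable {E : Type*} [NormedAddCommGroup E] [InnerProductSpace ℝ E] [FiniteDimensional ℝ E]

/-! Since `q` lies in the kernel of the first derivative, a step of order `t` along `q` and a step
of order `t ^ 2` inside `K` both contribute at order `t ^ 2`: one through the second derivative, the
other through the first. The interior condition lets these contributions realise every small vector
`z`, continuously in `z` (`exists_conic_curves`), so `G₀ (w₀ + h t z) = G₀ w₀ + t ^ 2 • z` up to a
small multiple of `t ^ 2`.

With `t` of order `√‖y - G₀ w₀‖`, this error, the perturbation `G - G₀` and the shift `y - G₀ w₀`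
together keep `z ↦ z - (G - y) / t ^ 2` inside a ball. `G` is only continuous, so Brouwer's theorem,
proved here, supplies the solution. -/

theorem exists_polynomial_eval_eq_det_one_add_smul (A : E →L[ℝ] E) :
    ∃ p : Polynomial ℝ, p.natDegree ≤ Module.finrank ℝ E ∧
      ∀ t : ℝ, p.eval t = (1 + t • A : E →L[ℝ] E).det := by
  classical
  let b := Module.finBasis ℝ E
  let M := LinearMap.toMatrix b b (A : E →ₗ[ℝ] E)
  let I : Matrix (Fin (Module.finrank ℝ E)) (Fin (Module.finrank ℝ E)) ℝ := 1
  refine ⟨((Polynomial.X : Polynomial ℝ) • M.map Polynomial.C + I.map Polynomial.C).det,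
    ?_, fun t => ?_⟩
  · simpa using Polynomial.natDegree_det_X_add_C_le M I
  · rw [ContinuousLinearMap.det, ← LinearMap.det_toMatrix b, ← Polynomial.coe_evalRingHom,
      RingHom.map_det]
    congr 1
    ext i j
    simp [M, I, LinearMap.toMatrix_apply, Matrix.one_apply, Finsupp.single_apply, apply_ite]
    by_cases h : i = j
    · simp [h, mul_comm, add_comm]
    · simp [h, Ne.symm h, mul_comm]

omit [FiniteDimensional ℝ E] in
theorem injective_one_add_of_norm_lt_one {A : E →L[ℝ] E} (hA : ‖A‖ < 1) :
    Function.Injective (1 + A : E →L[ℝ] E) := by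
  rw [injective_iff_map_eq_zero]
  intro v hv
  by_contra hne
  have h1 : v = -A v := by simpa [add_eq_zero_iff_eq_neg] using hv
  have h2 : ‖v‖ ≤ ‖A‖ * ‖v‖ := by
    conv_lhs => rw [h1, norm_neg]
    exact A.le_opNorm v
  nlinarith [norm_pos_iff.2 hne]

theorem det_ne_zero_of_injective {A : E →L[ℝ] E} (hA : Function.Injective A) : A.det ≠ 0 := by
  intro h
  obtain ⟨v, hv, hv0⟩ := (Submodule.ne_bot_iff _).1 (LinearMap.bot_lt_ker_of_det_eq_zero h).ne'
  exact hv0 (hA (by simpa using hv))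

theorem det_one_add_pos_of_norm_lt_one {A : E →L[ℝ] E} (hA : ‖A‖ < 1) :
    0 < (1 + A : E →L[ℝ] E).det := by
  by_contra! hneg
  have hcont : ContinuousOn (fun s : ℝ => (1 + s • A : E →L[ℝ] E).det) (Icc 0 1) :=
    (ContinuousLinearMap.continuous_det.comp (by fun_prop)).continuousOn
  have hmem : (0 : ℝ) ∈ Icc ((1 + (1 : ℝ) • A : E →L[ℝ] E).det) ((1 + (0 : ℝ) • A : E →L[ℝ] E).det) := by
    constructor
    · simpa using hneg
    · simp [ContinuousLinearMap.det]
  obtain ⟨s, hs, hs0⟩ := intermediate_value_Icc' zero_le_one hcont hmem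
  refine det_ne_zero_of_injective (injective_one_add_of_norm_lt_one ?_) hs0
  rw [norm_smul, Real.norm_of_nonneg hs.1]
  nlinarith [hs.2, norm_nonneg A]

/-- The image is open by the inverse function theorem and relatively closed in the ball, because
sphere points are fixed and so land outside it. Connectedness does the rest. -/
theorem image_ball_add_smul_eq_ball {g : E → E} {R K t : ℝ} (hR : 0 < R) (hg : ContDiff ℝ 1 g)
    (hsphere : ∀ x, ‖x‖ = R → g x = 0) (hball : ∀ x, ‖x‖ ≤ R → ‖x + g x‖ ≤ R)
    (hK : ∀ x, ‖x‖ ≤ R → ‖fderiv ℝ g x‖ ≤ K) (ht0 : 0 ≤ t) (ht1 : t < 1) (htK : t * K < 1) :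
    (fun x => x + t • g x) '' ball 0 R = ball 0 R := by
  have hmaps : ∀ x, ‖x‖ < R → ‖x + t • g x‖ < R := by
    intro x hx
    have : x + t • g x = (1 - t) • x + t • (x + g x) := by module
    rw [this]
    refine (norm_add_le _ _).trans_lt ?_
    rw [norm_smul, norm_smul, Real.norm_of_nonneg ht0, Real.norm_of_nonneg (by linarith)]
    nlinarith [hball x hx.le]
  have hcont : Continuous fun x => x + t • g x := by
    have := hg.continuous
    fun_prop
  refine Subset.antisymm ?_ ?_
  · rintro _ ⟨x, hx, rfl⟩
    simpa using hmaps x (by simpa using hx)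
  refine (convex_ball (0 : E) R).isPreconnected.subset_of_closure_inter_subset ?_ ?_ ?_
  · rw [isOpen_iff_mem_nhds]
    rintro _ ⟨x, hx, rfl⟩
    have hstrict : HasStrictFDerivAt (fun x => x + t • g x) (1 + t • fderiv ℝ g x) x :=
      (hasStrictFDerivAt_id x).add
        ((hg.contDiffAt.hasStrictFDerivAt (by norm_num)).const_smul t)
    have hinj : Function.Injective (1 + t • fderiv ℝ g x : E →L[ℝ] E) := by
      apply injective_one_add_of_norm_lt_one
      rw [norm_smul, Real.norm_of_nonneg ht0]
      have := hK x (by simpa using (mem_ball.1 hx).le)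
      nlinarith
    have hsurj : Function.Surjective (1 + t • fderiv ℝ g x : E →L[ℝ] E) :=
      (LinearMap.injective_iff_surjective
        (f := ((1 + t • fderiv ℝ g x : E →L[ℝ] E) : E →ₗ[ℝ] E))).1 hinj
    rw [← hstrict.map_nhds_eq_of_surj (LinearMap.range_eq_top.2 hsurj)]
    exact Filter.image_mem_map (isOpen_ball.mem_nhds hx)
  · exact ⟨0 + t • g 0, by simpa using hmaps 0 (by simpa using hR),
      ⟨0, by simpa using hR, rfl⟩⟩
  · rintro y ⟨hy, hyR⟩
    have hsub : closure ((fun x => x + t • g x) '' ball 0 R) ⊆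
        (fun x => x + t • g x) '' closedBall 0 R :=
      closure_minimal (image_mono ball_subset_closedBall)
        ((isCompact_closedBall 0 R).image hcont).isClosed
    obtain ⟨x, hx, rfl⟩ := hsub hy
    refine ⟨x, ?_, rfl⟩
    rcases (mem_closedBall_zero_iff.1 hx).lt_or_eq with h | h
    · simpa using h
    · simp [hsphere x h, h] at hyR

theorem integral_det_one_add_smul_fderiv [MeasurableSpace E] [BorelSpace E]
    {g : E → E} {R K t : ℝ} (hR : 0 < R) (hg : ContDiff ℝ 1 g)
    (hsphere : ∀ x, ‖x‖ = R → g x = 0) (hball : ∀ x, ‖x‖ ≤ R → ‖x + g x‖ ≤ R)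
    (hK : ∀ x, ‖x‖ ≤ R → ‖fderiv ℝ g x‖ ≤ K) (ht0 : 0 ≤ t) (ht1 : t < 1) (htK : t * K < 1) :
    ∫ x in ball (0 : E) R, (1 + t • fderiv ℝ g x : E →L[ℝ] E).det =
      (volume : Measure E).real (ball 0 R) := by
  have hinj : InjOn (fun x => x + t • g x) (ball (0 : E) R) := by
    intro x hx y hy hxy
    have hlip : ‖g x - g y‖ ≤ K * ‖x - y‖ :=
      (convex_ball (0 : E) R).norm_image_sub_le_of_norm_fderiv_le
        (fun z _ => (hg.differentiable (by norm_num)).differentiableAt)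
        (fun z hz => hK z (by simpa using (mem_ball.1 hz).le)) hy hx
    have hxy' : x - y = -(t • (g x - g y)) := by
      have : x + t • g x = y + t • g y := hxy
      rw [smul_sub, neg_sub, sub_eq_sub_iff_add_eq_add, this, add_comm]
    by_contra hne
    have hpos : 0 < ‖x - y‖ := norm_pos_iff.2 (sub_ne_zero.2 hne)
    have hle : ‖x - y‖ ≤ t * (K * ‖x - y‖) := by
      conv_lhs => rw [hxy', norm_neg, norm_smul, Real.norm_of_nonneg ht0]
      gcongr
    nlinarith
  have hcov := integral_image_eq_integral_abs_det_fderiv_smul (volume : Measure E)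
    (f := fun x => x + t • g x) (f' := fun x => 1 + t • fderiv ℝ g x) (s := ball (0 : E) R)
    measurableSet_ball
    (fun x _ => ((hasFDerivAt_id x).add
      (((hg.differentiable (by norm_num)) x).hasFDerivAt.const_smul t)).hasFDerivWithinAt)
    hinj (fun _ => (1 : ℝ))
  rw [image_ball_add_smul_eq_ball hR hg hsphere hball hK ht0 ht1 htK] at hcov
  simp only [setIntegral_const, smul_eq_mul, mul_one] at hcov
  rw [hcov]
  refine setIntegral_congr_fun measurableSet_ball fun x hx => ?_
  refine (abs_of_pos (det_one_add_pos_of_norm_lt_one ?_)).symm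
  rw [norm_smul, Real.norm_of_nonneg ht0]
  have := hK x (by simpa using (mem_ball.1 hx).le)
  nlinarith

/-- The determinant of `1 + t • g'` is a polynomial in `t` whose integral is the volume of the ball
for all small `t`, yet it vanishes at `t = 1`. -/
theorem not_contDiff_retraction_sphere {h : E → E} {R : ℝ} (hR : 0 < R) (hh : ContDiff ℝ 1 h)
    (hnorm : ∀ x, ‖h x‖ = R) (hid : ∀ x, ‖x‖ = R → h x = x) : False := by
  borelize E
  set g : E → E := fun x => h x - x with hgdef
  have hg : ContDiff ℝ 1 g := hh.sub contDiff_id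
  have hgc : Continuous (fderiv ℝ g) := hg.continuous_fderiv (by norm_num)
  obtain ⟨K, hK⟩ := (isCompact_closedBall (0 : E) R).exists_bound_of_continuousOn hgc.continuousOn
  set K' : ℝ := max K 1
  have hK' : ∀ x, ‖x‖ ≤ R → ‖fderiv ℝ g x‖ ≤ K' := fun x hx =>
    (hK x (by simpa using hx)).trans (le_max_left _ _)
  have hK'1 : 1 ≤ K' := le_max_right _ _
  have hdet1 : ∀ x, (1 + (1 : ℝ) • fderiv ℝ g x : E →L[ℝ] E).det = 0 := by
    intro x
    have hd := (hh.differentiable (by norm_num)) x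
    have h1 : (1 + (1 : ℝ) • fderiv ℝ g x : E →L[ℝ] E) = fderiv ℝ h x := by
      rw [hgdef, fderiv_fun_sub hd differentiableAt_fun_id, fderiv_fun_id]
      ext v
      simp
    rw [h1]
    by_contra hne
    have hsurj : Function.Surjective (fderiv ℝ h x) := by
      have hu : IsUnit (LinearMap.det (fderiv ℝ h x : E →ₗ[ℝ] E)) := isUnit_iff_ne_zero.2 hne
      exact ((Module.End.isUnit_iff _).1 ((LinearMap.isUnit_iff_isUnit_det _).2 hu)).2
    -- Constant norm makes the range of `h'` orthogonal to `h x`, so `h x` itself is not in it.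
    obtain ⟨v, hv⟩ := hsurj (h x)
    have hder : HasFDerivAt (fun y => inner ℝ (h y) (h y)) _ x :=
      hd.hasFDerivAt.inner ℝ hd.hasFDerivAt
    have hconst : (fun y => inner ℝ (h y) (h y)) = fun _ => R ^ 2 := by
      ext y
      rw [real_inner_self_eq_norm_sq, hnorm]
    rw [hconst] at hder
    have h0 := congrArg (fun L : E →L[ℝ] ℝ => L v) (hder.unique (hasFDerivAt_const _ x))
    simp [fderivInnerCLM_apply, hv, hnorm] at h0
    exact hR.ne' h0
  set n := Module.finrank ℝ E
  -- Interpolation at `n + 1` small nodes expresses the value at `t = 1` through values where the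
  -- volume is known.
  set τ : ℕ → ℝ := fun i => (1 / (2 * K')) * (1 / (i + 1)) with hτ
  have hKpos : 0 < 1 / (2 * K') := by positivity
  have hτinj : Function.Injective τ := by
    intro i j hij
    have := mul_left_cancel₀ hKpos.ne' hij
    simpa using this
  have hτ0 : ∀ i, 0 ≤ τ i := fun i => by positivity
  have hτle : ∀ i, τ i ≤ 1 / (2 * K') := fun i => by
    refine mul_le_of_le_one_right hKpos.le ?_
    rw [div_le_one (by positivity)]
    linarith [(Nat.cast_nonneg i : (0 : ℝ) ≤ i)]
  have hτK : ∀ i, τ i * K' < 1 := fun i => by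
    have := mul_le_mul_of_nonneg_right (hτle i) (by positivity : 0 ≤ K')
    have h2 : 1 / (2 * K') * K' = 1 / 2 := by field_simp
    linarith
  have hτ1 : ∀ i, τ i < 1 := fun i => by nlinarith [hτK i, hτ0 i]
  set c : ℕ → ℝ := fun i => (Lagrange.basis (Finset.range (n + 1)) τ i).eval 1
  have hsum : ∑ i ∈ Finset.range (n + 1), c i = 1 := by
    rw [← Polynomial.eval_finsetSum, Lagrange.sum_basis hτinj.injOn (by simp), Polynomial.eval_one]
  have hpt : ∀ x, ∑ i ∈ Finset.range (n + 1),
      (1 + τ i • fderiv ℝ g x : E →L[ℝ] E).det * c i = 0 := by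
    intro x
    obtain ⟨p, hpdeg, hp⟩ := exists_polynomial_eval_eq_det_one_add_smul (fderiv ℝ g x)
    have hpdeg' : p.degree < (Finset.range (n + 1)).card := by
      rw [Finset.card_range]
      exact Polynomial.degree_le_natDegree.trans_lt (by exact_mod_cast Nat.lt_succ_of_le hpdeg)
    have heq := congrArg (Polynomial.eval 1) (Lagrange.eq_interpolate (hτinj.injOn) hpdeg')
    rw [hp, hdet1, Lagrange.interpolate_apply, Polynomial.eval_finsetSum] at heq
    rw [heq]
    refine Finset.sum_congr rfl fun i _ => ?_
    rw [Polynomial.eval_mul, Polynomial.eval_C, hp]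
  have hint : ∫ x in ball (0 : E) R, ∑ i ∈ Finset.range (n + 1),
      (1 + τ i • fderiv ℝ g x : E →L[ℝ] E).det * c i = 0 := by
    simp [hpt]
  rw [integral_finsetSum] at hint
  · have hvol : ∀ i, ∫ x in ball (0 : E) R, (1 + τ i • fderiv ℝ g x : E →L[ℝ] E).det * c i =
        (volume : Measure E).real (ball 0 R) * c i := fun i => by
      rw [integral_mul_const, integral_det_one_add_smul_fderiv hR hg
        (fun x hx => by simp [hgdef, hid x hx]) (fun x _ => by simp [hgdef, hnorm]) hK'
        (hτ0 i) (hτ1 i) (hτK i)]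
    simp_rw [hvol] at hint
    rw [← Finset.mul_sum, hsum, mul_one] at hint
    exact (ENNReal.toReal_pos (measure_ball_pos _ _ hR).ne' measure_ball_lt_top.ne).ne' hint
  · intro i _
    have hc : Continuous fun x => (1 + τ i • fderiv ℝ g x : E →L[ℝ] E).det * c i :=
      (ContinuousLinearMap.continuous_det.comp (by fun_prop)).mul_const _
    exact (hc.continuousOn.integrableOn_compact (isCompact_closedBall 0 R)).mono_set
      ball_subset_closedBall

/-- Without a fixed point, `x - η x • e x` never vanishes and equals `x` on the sphere of radius `2
* r`; normalising it gives a forbidden retraction. -/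
theorem exists_fixedPoint_of_contDiff {e : E → E} {r : ℝ} (he : ContDiff ℝ 1 e)
    (hr : ∀ x, ‖e x‖ < r) : ∃ x, e x = x := by
  by_contra! hne
  have hr0 : 0 < r := (norm_nonneg _).trans_lt (hr 0)
  let η : ContDiffBump (0 : E) := ⟨r, 2 * r, hr0, by linarith⟩
  set u : E → E := fun x => x - η x • e x with hu
  have hu0 : ∀ x, u x ≠ 0 := by
    intro x hx
    have h1 : x = η x • e x := sub_eq_zero.1 hx
    have h2 : ‖x‖ ≤ r := by
      conv_lhs => rw [h1, norm_smul, Real.norm_of_nonneg η.nonneg]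
      nlinarith [hr x, η.le_one (x := x), norm_nonneg (e x), η.nonneg (x := x)]
    rw [η.one_of_mem_closedBall (by simpa using h2), one_smul] at h1
    exact hne x h1.symm
  have huC : ContDiff ℝ 1 u := contDiff_id.sub (η.contDiff.smul he)
  refine not_contDiff_retraction_sphere (h := fun x => (2 * r * ‖u x‖⁻¹) • u x) (R := 2 * r)
    (by positivity) ?_ ?_ ?_
  · exact (contDiff_const.mul ((huC.norm ℝ hu0).inv fun x => norm_ne_zero_iff.2 (hu0 x))).smul huC
  · intro x
    have := norm_pos_iff.2 (hu0 x)
    rw [norm_smul, Real.norm_of_nonneg (by positivity)]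
    field_simp
  · intro x hx
    have h1 : u x = x := by
      rw [hu]
      simp only
      rw [η.zero_of_le_dist (by simp [hx, η]), zero_smul, sub_zero]
    have h2 : (2 * r * (2 * r)⁻¹) = 1 := mul_inv_cancel₀ (by positivity)
    simp only [h1, hx, h2, one_smul]

theorem exists_fixedPoint_of_continuous {e : E → E} {r : ℝ} (he : Continuous e)
    (hr : ∀ x, ‖e x‖ ≤ r) : ∃ x, e x = x := by
  by_contra! hne
  have hr0 : 0 ≤ r := (norm_nonneg _).trans (hr 0)
  obtain ⟨x₀, -, hx₀⟩ := (isCompact_closedBall (0 : E) (3 * r + 1)).exists_isMinOn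
    ⟨0, by simpa using by positivity⟩ (f := fun x => ‖e x - x‖) (by fun_prop)
  have hδ : 0 < ‖e x₀ - x₀‖ := norm_pos_iff.2 (sub_ne_zero.2 (hne x₀))
  set δ := ‖e x₀ - x₀‖
  obtain ⟨ε, hε, hcont⟩ := Metric.uniformContinuousOn_iff.1
    ((isCompact_closedBall (0 : E) (3 * r + 2)).uniformContinuousOn_of_continuous he.continuousOn)
    (δ / 2) (half_pos hδ)
  obtain ⟨g, hg, hge⟩ := he.exists_contDiff_dist_le_of_forall_mem_ball_dist_le
    (lt_min one_pos hε)
  -- Values of `e` differ by at most `2 * r`, so its mollification stays within `2 * r` of `e`.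
  have hg3 : ∀ x, ‖g x‖ ≤ 3 * r := fun x => by
    have h1 := hge x (2 * r) fun y _ => by
      rw [dist_eq_norm]
      linarith [norm_sub_le (e y) (e x), hr x, hr y]
    rw [dist_eq_norm] at h1
    linarith [norm_le_norm_add_norm_sub' (g x) (e x), hr x]
  obtain ⟨x, hx⟩ := exists_fixedPoint_of_contDiff (hg.of_le (by norm_cast))
    (fun x => (hg3 x).trans_lt (lt_add_one _))
  have hxr : ‖x‖ ≤ 3 * r := by simpa [hx] using hg3 x
  have h1 := hge x (δ / 2) fun y hy => by
    rw [mem_ball, lt_min_iff] at hy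
    refine (hcont y ?_ x ?_ hy.2).le
    · rw [mem_closedBall_zero_iff]
      have := hy.1
      rw [dist_eq_norm] at this
      linarith [norm_le_norm_add_norm_sub' y x]
    · rw [mem_closedBall_zero_iff]
      linarith
  have h2 : δ ≤ ‖e x - x‖ := hx₀ (by rw [mem_closedBall_zero_iff]; linarith)
  rw [hx, dist_comm, dist_eq_norm] at h1
  linarith

/-- **Brouwer's fixed point theorem** for a closed ball of a Euclidean space. -/
theorem exists_fixedPoint_of_mapsTo_closedBall {φ : E → E} {r : ℝ} (hr : 0 < r)
    (hφ : ContinuousOn φ (closedBall 0 r)) (hmaps : MapsTo φ (closedBall 0 r) (closedBall 0 r)) :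
    ∃ x ∈ closedBall 0 r, φ x = x := by
  set π : E → E := fun x => (r * (max r ‖x‖)⁻¹) • x
  have hmax : ∀ x : E, 0 < max r ‖x‖ := fun x => hr.trans_le (le_max_left _ _)
  have hπmem : ∀ x, π x ∈ closedBall 0 r := fun x => by
    have := hmax x
    rw [mem_closedBall_zero_iff, norm_smul, Real.norm_of_nonneg (by positivity), mul_assoc]
    refine mul_le_of_le_one_right hr.le ?_
    rw [inv_mul_le_iff₀ this, mul_one]
    exact le_max_right _ _
  have hπid : ∀ x ∈ closedBall 0 r, π x = x := fun x hx => by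
    have : max r ‖x‖ = r := max_eq_left (by simpa using hx)
    simp only [π, this, mul_inv_cancel₀ hr.ne', one_smul]
  have hπ : Continuous π :=
    (continuous_const.mul ((by fun_prop : Continuous fun x : E => max r ‖x‖).inv₀
      fun x => (hmax x).ne')).smul continuous_id
  obtain ⟨x, hx⟩ := exists_fixedPoint_of_continuous (hφ.comp_continuous hπ hπmem)
    (fun x => by simpa using hmaps (hπmem x))
  have hxr : x ∈ closedBall 0 r := by
    have := hmaps (hπmem x)
    rwa [show φ (π x) = x from hx] at this
  exact ⟨x, hxr, by simpa [hπid x hxr] using hx⟩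

end Brouwer
-- Second-order expansion and curves in the cone.
section SecondOrder

open Metric Set Asymptotics

variable {X E : Type*} [NormedAddCommGroup X] [NormedSpace ℝ X]
  [NormedAddCommGroup E] [NormedSpace ℝ E]

theorem TwiceDifferentiableAt.eventually_norm_taylor_le {f : X → E} {x : X}
    (hf : TwiceDifferentiableAt f x) {ε : ℝ} (hε : 0 < ε) :
    ∀ᶠ h in 𝓝 (0 : X), ‖f (x + h) - f x - fderiv ℝ f x h - (1 / 2 : ℝ) • secondDeriv f x h h‖
      ≤ ε * ‖h‖ ^ 2 := by
  have h2 : ∀ᶠ w in 𝓝 x,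
      ‖fderiv ℝ f w - fderiv ℝ f x - secondDeriv f x (w - x)‖ ≤ ε * ‖w - x‖ :=
    hf.2.hasFDerivAt.isLittleO.def hε
  obtain ⟨δ, hδ, hball⟩ := Metric.eventually_nhds_iff_ball.1 (hf.1.and h2)
  refine Metric.eventually_nhds_iff_ball.2 ⟨δ, hδ, fun h hh => ?_⟩
  have hmem : ∀ s ∈ Icc (0 : ℝ) 1, x + s • h ∈ ball x δ := fun s hs => by
    rw [mem_ball_iff_norm, add_sub_cancel_left, norm_smul, Real.norm_of_nonneg hs.1]
    have := mem_ball_zero_iff.1 hh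
    nlinarith [hs.2, norm_nonneg h]
  set φ : ℝ → E := fun s => f (x + s • h) - s • fderiv ℝ f x h -
    (s ^ 2 / 2) • secondDeriv f x h h
  have hder : ∀ s ∈ Icc (0 : ℝ) 1, HasDerivAt φ (fderiv ℝ f (x + s • h) h - fderiv ℝ f x h -
      s • secondDeriv f x h h) s := by
    intro s hs
    have hl : HasDerivAt (fun s : ℝ => x + s • h) h s := by
      simpa using ((hasDerivAt_id s).smul_const h).const_add x
    have h1 := ((hball _ (hmem s hs)).1.hasFDerivAt).comp_hasDerivAt s hl
    have h3 : HasDerivAt (fun s : ℝ => s • fderiv ℝ f x h) (fderiv ℝ f x h) s := by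
      simpa using (hasDerivAt_id s).smul_const (fderiv ℝ f x h)
    have h4 : HasDerivAt (fun s : ℝ => (s ^ 2 / 2) • secondDeriv f x h h)
        (s • secondDeriv f x h h) s := by
      have := (((hasDerivAt_id s).pow 2).div_const 2).smul_const (secondDeriv f x h h)
      simpa using this
    exact (h1.sub h3).sub h4
  have hbound : ∀ s ∈ Ico (0 : ℝ) 1, ‖fderiv ℝ f (x + s • h) h - fderiv ℝ f x h -
      s • secondDeriv f x h h‖ ≤ ε * ‖h‖ ^ 2 := by
    intro s hs
    have h1 := (hball _ (hmem s ⟨hs.1, hs.2.le⟩)).2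
    rw [add_sub_cancel_left, norm_smul, Real.norm_of_nonneg hs.1] at h1
    have h3 := ContinuousLinearMap.le_of_opNorm_le _ h1 h
    simp only [sub_apply, map_smul, smul_apply] at h3
    refine h3.trans ?_
    have : s * (ε * ‖h‖ ^ 2) ≤ 1 * (ε * ‖h‖ ^ 2) := by
      gcongr
      exact hs.2.le
    nlinarith
  have := norm_image_sub_le_of_norm_deriv_le_segment_01'
    (fun s hs => (hder s hs).hasDerivWithinAt) hbound
  convert this using 2
  simp only [φ, one_smul, zero_smul, add_zero, one_pow, ne_eq, OfNat.ofNat_ne_zero,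
    not_false_eq_true, zero_pow, zero_div, sub_zero]
  abel

/-- Preimages are chosen only at the vertices of a simplex around `0`; barycentric coordinates,
nonnegative on the simplex, interpolate them continuously. -/
theorem exists_continuous_conic_selection [FiniteDimensional ℝ E] (K : ConvexCone ℝ X) (w : X)
    (A : X →L[ℝ] E) (a : E)
    (hint : (0 : E) ∈ interior (A '' ((K : Set X) - {w}) + ray a)) :
    ∃ ρ : ℝ, 0 < ρ ∧ ∃ ξ : E → X, ∃ β : E → ℝ, Continuous ξ ∧ Continuous β ∧
      ∀ z ∈ closedBall (0 : E) ρ, ξ z ∈ K ∧ 0 ≤ β z ∧ A (ξ z - w) + β z • a = z := by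
  obtain ⟨b, hb0, hb⟩ := exists_mem_interior_convexHull_affineBasis (mem_interior_iff_mem_nhds.1 hint)
  have hsel : ∀ i, ∃ x ∈ K, ∃ β : ℝ, 0 ≤ β ∧ A (x - w) + β • a = b i := by
    intro i
    obtain ⟨_, ⟨_, ⟨x, hx, _, rfl, rfl⟩, rfl⟩, _, ⟨β, hβ, rfl⟩, h⟩ :=
      hb (subset_convexHull ℝ _ (mem_range_self i))
    exact ⟨x, hx, β, hβ, h⟩
  choose x hxK β hβ hxβ using hsel
  obtain ⟨ρ, hρ, hball⟩ := Metric.nhds_basis_closedBall.mem_iff.1 (mem_interior_iff_mem_nhds.1 hb0)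
  have hcoord : ∀ i, Continuous (b.coord i) := fun i => (b.coord i).continuous_of_finiteDimensional
  refine ⟨ρ, hρ, fun z => ∑ i, b.coord i z • x i, fun z => ∑ i, b.coord i z * β i,
    continuous_finsetSum _ fun i _ => (hcoord i).smul continuous_const,
    continuous_finsetSum _ fun i _ => (hcoord i).mul continuous_const, fun z hz => ?_⟩
  have hnonneg : ∀ i, 0 ≤ b.coord i z := by
    have := hball hz
    rwa [b.convexHull_eq_nonneg_coord] at this
  have hsum : ∑ i, b.coord i z = 1 := b.sum_coord_apply_eq_one z
  refine ⟨K.convex.sum_mem (fun i _ => hnonneg i) hsum fun i _ => hxK i,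
    Finset.sum_nonneg fun i _ => mul_nonneg (hnonneg i) (hβ i), ?_⟩
  have hw : ∑ i, b.coord i z • x i - w = ∑ i, b.coord i z • (x i - w) := by
    simp_rw [smul_sub]
    rw [Finset.sum_sub_distrib, ← Finset.sum_smul, hsum, one_smul]
  rw [hw, map_sum, Finset.sum_smul, ← Finset.sum_add_distrib]
  conv_rhs => rw [← b.linear_combination_coord_eq_self z]
  refine Finset.sum_congr rfl fun i _ => ?_
  rw [← hxβ i, map_smul, smul_add, mul_smul]

theorem exists_conic_curves [FiniteDimensional ℝ E] (K : ConvexCone ℝ X) {w q : X} (hw : w ∈ K)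
    (hq : q ∈ K) (A : X →L[ℝ] E) (B : X →L[ℝ] X →L[ℝ] E) (hAq : A q = 0)
    (hint : (0 : E) ∈ interior (A '' ((K : Set X) - {w}) + ray (B q q))) :
    ∃ ρ : ℝ, 0 < ρ ∧ ∃ C : ℝ, 0 < C ∧ ∃ h : ℝ → E → X, (∀ t, Continuous (h t)) ∧
      ∀ t, 0 < t → t < 1 → ∀ z ∈ closedBall (0 : E) ρ, w + h t z ∈ K ∧ ‖h t z‖ ≤ C * t ∧
        ‖A (h t z) + (1 / 2 : ℝ) • B (h t z) (h t z) - t ^ 2 • z‖ ≤ C * t ^ 3 := by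
  obtain ⟨ρ, hρ, ξ, β, hξ, hβ, hsel⟩ := exists_continuous_conic_selection K w A (B q q) hint
  -- Chosen so that half the second-order term of `γ • q` is exactly `β • B q q`.
  set γ : E → ℝ := fun z => √(2 * β z)
  have hγ : Continuous γ := by fun_prop
  set u : E → E := fun z => (γ z / 2) • (B q (ξ z - w) + B (ξ z - w) q)
  set v : E → E := fun z => (1 / 2 : ℝ) • B (ξ z - w) (ξ z - w)
  have hu : Continuous u := by fun_prop
  have hv : Continuous v := by fun_prop
  obtain ⟨C₁, hC₁⟩ := (isCompact_closedBall (0 : E) ρ).exists_bound_of_continuousOn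
    (f := fun z => ‖γ z • q‖ + ‖ξ z - w‖) (by fun_prop)
  obtain ⟨C₂, hC₂⟩ := (isCompact_closedBall (0 : E) ρ).exists_bound_of_continuousOn
    (f := fun z => ‖u z‖ + ‖v z‖) (by fun_prop)
  refine ⟨ρ, hρ, max (max C₁ C₂) 1, by positivity,
    fun t z => t • γ z • q + t ^ 2 • (ξ z - w), fun t => by fun_prop, ?_⟩
  intro t ht0 ht1 z hz
  obtain ⟨hξK, hβ0, hz'⟩ := hsel z hz
  have ht2 : t ^ 2 ≤ t := by nlinarith
  have hC₁' := (Real.le_norm_self _).trans (hC₁ z hz)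
  have hC₂' := (Real.le_norm_self _).trans (hC₂ z hz)
  refine ⟨?_, ?_, ?_⟩
  · have hbase : (1 - t ^ 2) • w + t ^ 2 • ξ z ∈ K :=
      K.convex hw hξK (by linarith) (by positivity) (by ring)
    have heq : w + (t • γ z • q + t ^ 2 • (ξ z - w)) =
        ((1 - t ^ 2) • w + t ^ 2 • ξ z) + (t * γ z) • q := by module
    rw [heq]
    -- The cone is closed only under positive scalars and need not contain `0`.
    rcases (mul_nonneg ht0.le (Real.sqrt_nonneg (2 * β z))).eq_or_lt' with h | h
    · rw [h, zero_smul, add_zero]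
      exact hbase
    · exact K.add_mem hbase (K.smul_mem h hq)
  · calc ‖t • γ z • q + t ^ 2 • (ξ z - w)‖ ≤ t * ‖γ z • q‖ + t ^ 2 * ‖ξ z - w‖ := by
          refine (norm_add_le _ _).trans ?_
          rw [norm_smul t, norm_smul (t ^ 2), Real.norm_of_nonneg ht0.le,
            Real.norm_of_nonneg (by positivity)]
      _ ≤ t * ‖γ z • q‖ + t * ‖ξ z - w‖ := by gcongr
      _ = (‖γ z • q‖ + ‖ξ z - w‖) * t := by ring
      _ ≤ max (max C₁ C₂) 1 * t := by
          gcongr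
          exact hC₁'.trans ((le_max_left _ _).trans (le_max_left _ _))
  · have hγ2 : γ z ^ 2 = 2 * β z := Real.sq_sqrt (by positivity)
    have heq : A (t • γ z • q + t ^ 2 • (ξ z - w)) + (1 / 2 : ℝ) •
        B (t • γ z • q + t ^ 2 • (ξ z - w)) (t • γ z • q + t ^ 2 • (ξ z - w)) - t ^ 2 • z =
        t ^ 3 • u z + t ^ 4 • v z := by
      have hz2 : t ^ 2 • z = t ^ 2 • A (ξ z - w) + (t ^ 2 * (γ z ^ 2 / 2)) • B q q := by
        conv_lhs => rw [← hz']
        rw [hγ2]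
        module
      rw [hz2]
      simp only [u, v]
      generalize ξ z - w = d
      simp only [map_add, map_smul, hAq, add_apply,
        smul_apply]
      module
    rw [heq]
    calc ‖t ^ 3 • u z + t ^ 4 • v z‖ ≤ t ^ 3 * ‖u z‖ + t ^ 4 * ‖v z‖ := by
          refine (norm_add_le _ _).trans ?_
          rw [norm_smul (t ^ 3), norm_smul (t ^ 4), Real.norm_of_nonneg (by positivity),
            Real.norm_of_nonneg (by positivity)]
      _ ≤ t ^ 3 * ‖u z‖ + t ^ 3 * ‖v z‖ :=
          add_le_add le_rfl (mul_le_mul_of_nonneg_right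
            (pow_le_pow_of_le_one ht0.le ht1.le (by norm_num)) (norm_nonneg _))
      _ = (‖u z‖ + ‖v z‖) * t ^ 3 := by ring
      _ ≤ max (max C₁ C₂) 1 * t ^ 3 := by
          gcongr
          exact hC₂'.trans ((le_max_right _ _).trans (le_max_left _ _))

omit [NormedSpace ℝ X] [NormedSpace ℝ E] in
theorem continuousOn_zeroExtend {V : Set X} {G : V → E} (hG : Continuous G) :
    ContinuousOn (zeroExtend G) V := by
  rw [continuousOn_iff_continuous_domRestrict]
  convert hG using 1
  ext w
  exact zeroExtend_apply G w

end SecondOrder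


/-! ### The perturbed equation. -/

theorem theorem2 {X : Type*} [NormedAddCommGroup X] [NormedSpace ℝ X] {m : ℕ}
    (K : ConvexCone ℝ X) (V : Set X) (w₀ : V) (hV : V ∈ 𝓝 (w₀ : X)) (hw₀ : (w₀ : X) ∈ K)
    (G₀ : V →ᵇ EuclideanSpace ℝ (Fin m))
    (hG₀ : TwiceDifferentiableAt (zeroExtend G₀) (w₀ : X))
    (q : X) (hq_ker : fderiv ℝ (zeroExtend G₀) (w₀ : X) q = 0) (hqK : q ∈ K) (hq : ‖q‖ = 1)
    (hint : (0 : EuclideanSpace ℝ (Fin m)) ∈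
      interior (fderiv ℝ (zeroExtend G₀) (w₀ : X) '' ((K : Set X) - {(w₀ : X)}) +
        ray (secondDeriv (zeroExtend G₀) (w₀ : X) q q))) :
    ∃ V₁ ∈ 𝓝 (G₀ w₀), ∃ κ : ℝ, 0 < κ ∧
      ∀ y ∈ V₁, ∃ Vy : Set (V →ᵇ EuclideanSpace ℝ (Fin m)),
        (y ≠ G₀ w₀ → Vy ∈ 𝓝 G₀) ∧ (y = G₀ w₀ → Vy = {G₀}) ∧
        ∀ G ∈ Vy, ∃ w : V, (w : X) ∈ K ∧ G w = y ∧
          ‖(w : X) - (w₀ : X)‖ ≤ κ * √‖y - G₀ w₀‖ := by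
  set f := zeroExtend G₀ with hf
  set y₀ := G₀ w₀ with hy₀
  have hfw₀ : f w₀ = y₀ := zeroExtend_apply G₀ w₀
  obtain ⟨ρ, hρ, C, hC, h, hcont, hh⟩ := exists_conic_curves K hw₀ hqK (fderiv ℝ f w₀)
    (secondDeriv f w₀) hq_ker hint
  have hVev : ∀ᶠ k in 𝓝 (0 : X), (w₀ : X) + k ∈ V :=
    (by fun_prop : Continuous fun k : X => (w₀ : X) + k).continuousAt.eventually_mem
      (by simpa using hV)
  obtain ⟨δ, hδ, hball⟩ := Metric.eventually_nhds_iff_ball.1 (hVev.and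
    (hG₀.eventually_norm_taylor_le (show 0 < ρ / (6 * C ^ 2) by positivity)))
  -- The bounds keep the curves valid, make `C * t ^ 3` at most `ρ / 6 * t ^ 2`, and keep `h t z`
  -- where the Taylor estimate holds.
  set t₀ := min 1 (min (ρ / (6 * C)) (δ / C)) with ht₀
  have ht₀pos : 0 < t₀ := by positivity
  refine ⟨Metric.ball y₀ (ρ / 3 * t₀ ^ 2), Metric.ball_mem_nhds _ (by positivity),
    C * √(3 / ρ), by positivity, fun y hy => ?_⟩
  by_cases hyy : y = y₀
  · refine ⟨{G₀}, fun hne => absurd hyy hne, fun _ => rfl, ?_⟩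
    rintro G rfl
    exact ⟨w₀, hw₀, by rw [hyy], by simp [hyy]⟩
  have hypos : 0 < ‖y - y₀‖ := norm_pos_iff.2 (sub_ne_zero.2 hyy)
  -- This makes `‖y - y₀‖ = ρ / 3 * t ^ 2`: one third of the budget `ρ * t ^ 2` goes to `y`, one to
  -- `G - G₀`, one to the expansion error.
  set t := √(3 / ρ * ‖y - y₀‖) with ht
  have htpos : 0 < t := by positivity
  have htsq : t ^ 2 = 3 / ρ * ‖y - y₀‖ := Real.sq_sqrt (by positivity)
  have hyt : ‖y - y₀‖ = ρ / 3 * t ^ 2 := by rw [htsq]; field_simp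
  have htt₀ : t < t₀ := by
    rw [mem_ball_iff_norm, hyt] at hy
    exact lt_of_pow_lt_pow_left₀ 2 ht₀pos.le (lt_of_mul_lt_mul_left hy (by positivity))
  have ht1 : t < 1 := htt₀.trans_le (min_le_left _ _)
  have htρ : C * t ≤ ρ / 6 := by
    have := htt₀.le.trans ((min_le_right _ _).trans (min_le_left _ _))
    rw [le_div_iff₀ (by positivity)] at this
    linarith
  have htδ : C * t < δ := by
    have := htt₀.trans_le ((min_le_right _ _).trans (min_le_right _ _))
    rw [lt_div_iff₀ (by positivity)] at this
    linarith
  refine ⟨Metric.ball G₀ (ρ / 3 * t ^ 2), fun _ => Metric.ball_mem_nhds _ (by positivity),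
    fun h => absurd h hyy, fun G hG => ?_⟩
  have hV' : ∀ z ∈ Metric.closedBall (0 : EuclideanSpace ℝ (Fin m)) ρ, (w₀ : X) + h t z ∈ V :=
    fun z hz => (hball _ (by simpa using ((hh t htpos ht1 z hz).2.1.trans_lt htδ))).1
  have hexp : ∀ z ∈ Metric.closedBall (0 : EuclideanSpace ℝ (Fin m)) ρ,
      ‖f (w₀ + h t z) - y₀ - t ^ 2 • z‖ ≤ ρ / 3 * t ^ 2 := by
    intro z hz
    obtain ⟨-, hn, hq⟩ := hh t htpos ht1 z hz
    have htay := (hball _ (by simpa using hn.trans_lt htδ)).2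
    rw [hfw₀] at htay
    have h1 : ρ / (6 * C ^ 2) * ‖h t z‖ ^ 2 ≤ ρ / 6 * t ^ 2 := by
      calc ρ / (6 * C ^ 2) * ‖h t z‖ ^ 2 ≤ ρ / (6 * C ^ 2) * (C * t) ^ 2 := by gcongr
        _ = ρ / 6 * t ^ 2 := by field_simp
    have h2 : C * t ^ 3 ≤ ρ / 6 * t ^ 2 := by
      calc C * t ^ 3 = C * t * t ^ 2 := by ring
        _ ≤ ρ / 6 * t ^ 2 := by gcongr
    have h3 := norm_add_le_of_le (htay.trans h1) (hq.trans h2)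
    calc ‖f (w₀ + h t z) - y₀ - t ^ 2 • z‖ ≤ ρ / 6 * t ^ 2 + ρ / 6 * t ^ 2 := by
          refine le_of_eq_of_le (congrArg norm ?_) h3
          abel
      _ = ρ / 3 * t ^ 2 := by ring
  set Φ : EuclideanSpace ℝ (Fin m) → EuclideanSpace ℝ (Fin m) :=
    fun z => z - (t ^ 2)⁻¹ • (zeroExtend G (w₀ + h t z) - y) with hΦ
  have hΦcont : ContinuousOn Φ (Metric.closedBall 0 ρ) := by
    have h1 : ContinuousOn (fun z => zeroExtend G ((w₀ : X) + h t z)) (Metric.closedBall 0 ρ) :=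
      (continuousOn_zeroExtend G.continuous).comp
        (continuous_const.add (hcont t)).continuousOn hV'
    fun_prop
  have hΦmaps : Set.MapsTo Φ (Metric.closedBall 0 ρ) (Metric.closedBall 0 ρ) := by
    intro z hz
    have hGd : ‖f (w₀ + h t z) - zeroExtend G (w₀ + h t z)‖ ≤ ρ / 3 * t ^ 2 := by
      have h1 := zeroExtend_apply G₀ ⟨_, hV' z hz⟩
      have h2 := zeroExtend_apply G ⟨_, hV' z hz⟩
      simp only at h1 h2
      rw [hf, h1, h2, ← dist_eq_norm]
      exact (BoundedContinuousFunction.dist_coe_le_dist _).trans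
        (by rw [dist_comm]; exact (Metric.mem_ball.1 hG).le)
    have hsplit : Φ z = (t ^ 2)⁻¹ • (-(f (w₀ + h t z) - y₀ - t ^ 2 • z) +
        (f (w₀ + h t z) - zeroExtend G (w₀ + h t z)) + (y - y₀)) := by
      have hz' : z = (t ^ 2)⁻¹ • t ^ 2 • z := by
        rw [smul_smul, inv_mul_cancel₀ (by positivity), one_smul]
      rw [hΦ]
      simp only
      nth_rw 1 [hz']
      module
    rw [mem_closedBall_zero_iff, hsplit, norm_smul, Real.norm_of_nonneg (by positivity),
      inv_mul_le_iff₀ (by positivity)]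
    refine (norm_add₃_le).trans ?_
    rw [norm_neg]
    linarith [hexp z hz]
  obtain ⟨z, hz, hfix⟩ := exists_fixedPoint_of_mapsTo_closedBall hρ hΦcont hΦmaps
  refine ⟨⟨_, hV' z hz⟩, (hh t htpos ht1 z hz).1, ?_, ?_⟩
  · have h1 : (t ^ 2)⁻¹ • (zeroExtend G (w₀ + h t z) - y) = 0 := by
      simpa [hΦ] using hfix
    have h2 := sub_eq_zero.1 ((smul_eq_zero.1 h1).resolve_left (by positivity))
    rw [← h2]
    exact (zeroExtend_apply G ⟨_, hV' z hz⟩).symm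
  · rw [add_sub_cancel_left, mul_assoc, ← Real.sqrt_mul (by positivity)]
    exact (hh t htpos ht1 z hz).2.1
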